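/- Let $(A,\mathscr{A},\mu)$ be a complete non-atomic measure space with $0<\mu(A)<\infty$ (non-atomic: every measurable set of positive measure contains a measurable subset of strictly smaller positive measure), and let $(\Omega,\mathscr{F},\mathbb{P})$ be a probability space whose $\sigma$-algebra $\mathscr{F}$ is finite. A risk measure is a functional $\varrho:L^\infty(\mathbb{P})\to\mathbb{R}$ that is monotone ($\mathcal{X}\ge\mathcal{Y}$ implies $\varrho(\mathcal{X})\ge\varrho(\mathcal{Y})$) and cash additive ($\varrho(\mathcal{X}+c)=\varrho(\mathcal{X})+c$ for $c\in\mathbb{R}$). Its convex conjugate is $$\varrho^*(\mathcal{Y})=\sup_{\mathcal{X}\in L^\infty(\mathbb{P})}\bigl(\mathbb{E}^{\mathbb{P}}(\mathcal{X}\mathcal{Y})-\varrho(\mathcal{X})\bigr),\qquad \mathcal{Y}\in L^1(\mathbb{P}),$$ and $\varrho$ is called conjugately degenerate if $\varrho^*(d\mathbb{Q}/d\mathbb{P})=\infty$ for every probability measure $\mathbb{Q}\ll\mathbb{P}$ on $\mathscr{F}$. An allocation is a map $a\mapsto X_a$ from $A$ to $L^\infty(\mathbb{P})$; it is measurable if $a\mapsto\mathbb{E}^{\mathbb{P}}(X_a\mathcal{Y})$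 is $\mathscr{A}$-measurable for every $\mathcal{Y}\in L^1(\mathbb{P})$. For $\mathcal{X}\in L^\infty(\mathbb{P})$, let $\mathbb{A}(\mathcal{X})$ be the set of measurable allocations $(X_a)_{a\in A}$ such that, for every $\mathcal{Y}\in L^1(\mathbb{P})$, the function $a\mapsto\mathbb{E}^{\mathbb{P}}(X_a\mathcal{Y})$ is $\mu$-integrable and $\int_A\mathbb{E}^{\mathbb{P}}(X_a\mathcal{Y})\,\mu(da)=\mathbb{E}^{\mathbb{P}}(\mathcal{X}\mathcal{Y})$. Let $(\varrho_a)_{a\in A}$ be a family of risk measures on $L^\infty(\mathbb{P})$ such that $a\mapsto\varrho_a(X_a)$ is $\mathscr{A}$-measurable for every measurable allocation $(X_a)_{a\in A}$. Its integral infimal convolution is $$\Bigl(\mathop{\Box}_{a\in A}\varrho_a\,\mu(da)\Bigr)(\mathcal{X})=\inf_{(X_a)\in\mathbb{A}(\mathcal{X})}\int_A\varrho_a(X_a)\,\mu(da)\in[-\infty,\infty],\qquad\mathcal{X}\in L^\infty(\mathbb{P}),$$ where the integral is set equal to $+\infty$ whenever the positive part of $a\mapsto\varrho_a(X_a)$ has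 infinite integral. Suppose that $\varrho_a$ is conjugately degenerate for every $a\in A$. Then $\mathop{\Box}_{a\in A}\varrho_a\,\mu(da)$ is identically $+\infty$ on $L^\infty(\mathbb{P})$ or identically $-\infty$ on $L^\infty(\mathbb{P})$. -/

import Mathlib

open MeasureTheory
open scoped ENNReal

noncomputable section

namespace RiskSharing

/-- A measure is non-atomic if it has no atoms: every measurable set of positive measure contains
a measurable subset of strictly smaller positive measure. (For finite measures this is stronger
than the class `NullSingletonClass`, which only says that singletons are null.) -/
def NonAtomic {A : Type*} [MeasurableSpace A] (μ : Measure A) : Prop :=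
  ∀ s : Set A, MeasurableSet s → 0 < μ s →
    ∃ t : Set A, MeasurableSet t ∧ t ⊆ s ∧ 0 < μ t ∧ μ t < μ s

section Probability

variable {Ω : Type*} [MeasurableSpace Ω] {P : Measure Ω}

/-- The pairing `E^P(X Y)` of `X ∈ L^∞(P)` and `Y ∈ L^1(P)`. -/
def pairing (X : Lp ℝ ∞ P) (Y : Lp ℝ 1 P) : ℝ :=
  ∫ ω, X ω * Y ω ∂P

/-- A (real-valued) risk measure on `L^∞(P)`: monotone and cash additive, where `X ≥ 0` is
a loss. -/
structure IsRiskMeasure [IsFiniteMeasure P] (ρ : Lp ℝ ∞ P → ℝ) : Prop where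
  monotone : ∀ X Y : Lp ℝ ∞ P, Y ≤ X → ρ Y ≤ ρ X
  cash_additive : ∀ (X : Lp ℝ ∞ P) (c : ℝ), ρ (X + Lp.const ∞ P c) = ρ X + c

/-- The convex conjugate `ρ^*(Y) = sup_X (E^P(X Y) - ρ(X))`, with values in `[-∞, ∞]`. -/
def convexConjugate (ρ : Lp ℝ ∞ P → ℝ) (Y : Lp ℝ 1 P) : EReal :=
  ⨆ X : Lp ℝ ∞ P, ((pairing X Y - ρ X : ℝ) : EReal)

variable (P) in
/-- The set of probability measures `Q ≪ P`, viewed as a subset of `L^1(P)` by identifying `Q`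
with its Radon-Nikodym density `dQ/dP`. -/
def absContProbabilities : Set (Lp ℝ 1 P) :=
  {Y | ∃ Q : Measure Ω, IsProbabilityMeasure Q ∧ Q ≪ P ∧
    (Y : Ω → ℝ) =ᵐ[P] fun ω => (Q.rnDeriv P ω).toReal}

/-- Conjugate degeneracy: `ρ^*` takes only the value `∞` on the probability measures `Q ≪ P`. -/
def ConjugatelyDegenerate (ρ : Lp ℝ ∞ P → ℝ) : Prop :=
  convexConjugate ρ '' absContProbabilities P = {⊤}

end Probability

section Agents

variable {A : Type*} [MeasurableSpace A] {Ω : Type*} [MeasurableSpace Ω] {P : Measure Ω}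

/-- An allocation `(X_a)` is measurable if `a ↦ E^P(X_a Y)` is measurable for each
`Y ∈ L^1(P)`. -/
def MeasurableAllocation (X : A → Lp ℝ ∞ P) : Prop :=
  ∀ Y : Lp ℝ 1 P, Measurable fun a => pairing (X a) Y

/-- A measurable allocation is Gelfand integrable if each `a ↦ E^P(X_a Y)` is integrable. -/
def GelfandIntegrable (μ : Measure A) (X : A → Lp ℝ ∞ P) : Prop :=
  MeasurableAllocation X ∧ ∀ Y : Lp ℝ 1 P, Integrable (fun a => pairing (X a) Y) μ

/-- `Z ∈ L^∞(P)` is the Gelfand integral of `(X_a)` over the agent space: it is the (unique)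
element with `E^P(Z Y) = ∫ E^P(X_a Y) μ(da)` for every `Y ∈ L^1(P)`. -/
def IsGelfandIntegral (μ : Measure A) (X : A → Lp ℝ ∞ P) (Z : Lp ℝ ∞ P) : Prop :=
  ∀ Y : Lp ℝ 1 P, pairing Z Y = ∫ a, pairing (X a) Y ∂μ

/-- The set of `Z`-feasible allocations. -/
def feasibleAllocations (μ : Measure A) (Z : Lp ℝ ∞ P) : Set (A → Lp ℝ ∞ P) :=
  {X | GelfandIntegrable μ X ∧ IsGelfandIntegral μ X Z}

/-- A family of functionals is measurable if `a ↦ ρ_a(X_a)` is measurable for each measurable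
allocation `(X_a)`. -/
def MeasurablePreferences (ρ : A → Lp ℝ ∞ P → ℝ) : Prop :=
  ∀ X : A → Lp ℝ ∞ P, MeasurableAllocation X → Measurable fun a => ρ a (X a)

open Classical in
/-- The extended integral of a measurable `f : A → ℝ`: it is `∫ f⁺ dμ - ∫ f⁻ dμ ∈ [-∞, ∞]`, with
the convention that it is `+∞` whenever `∫ f⁺ dμ = ∞` (even if also `∫ f⁻ dμ = ∞`). -/
def extendedIntegral (μ : Measure A) (f : A → ℝ) : EReal :=
  if ∫⁻ a, ENNReal.ofReal (f a) ∂μ = ∞ then ⊤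
  else ((∫⁻ a, ENNReal.ofReal (f a) ∂μ : ℝ≥0∞) : EReal)
    - ((∫⁻ a, ENNReal.ofReal (-f a) ∂μ : ℝ≥0∞) : EReal)

/-- The integral infimal convolution `Z ↦ inf ∫ ρ_a(X_a) μ(da)`, the infimum being over the
`Z`-feasible allocations `(X_a)`. -/
def integralInfConv (μ : Measure A) (ρ : A → Lp ℝ ∞ P → ℝ) (Z : Lp ℝ ∞ P) : EReal :=
  ⨅ X ∈ feasibleAllocations μ Z, extendedIntegral μ fun a => ρ a (X a)

end Agents

end RiskSharing

end

/-! Suppose the convolution is below `⊤` at `Z₀` and above `⊥` at `Z₁`. Since the σ-algebra is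
finite, `L^∞` is finite-dimensional and every functional on it is a pairing, so feasible allocations
are Bochner integrable maps with prescribed integral. Risk measures are 1-Lipschitz; moving an
allocation from `Z₀` to `Z₁` by a constant therefore yields one allocation with integrable risk, and
then every integrable allocation has integrable risk.

No `ρ a` need be convex, but non-atomicity convexifies the integral: two allocations are mixed by
giving each to a suitable set of agents. An approximate Lyapunov theorem
(`NonAtomic.exists_setIntegral_near`) suffices, because a small error in the total is repaired by a
shift whose cost is controlled by the Lipschitz bound. Hence the strict epigraph is open and convex,
and Hahn–Banach gives an affine minorant with slope `g` (`NonAtomic.exists_affine_minorant`).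

Monotonicity and cash additivity make `g` positive and normalized, so it is the expectation under
some Q ≪ P. The minorant bounds the conjugate of the convolution at Q. Yet each agent's conjugate at
Q is infinite, and a measurable choice of near-maximizers makes the conjugate of the convolution
infinite too (`exists_integral_sub_gt_of_unbounded`), a contradiction. -/

namespace RiskSharing

/-! ### Non-atomic measures: Sierpiński and approximate Lyapunov. -/

section NonAtomic

variable {A : Type*} [MeasurableSpace A] {μ : Measure A} [IsFiniteMeasure μ]

/-- A proper piece and its complement in `s` both have positive measure, and one of them has at most
half. -/
theorem NonAtomic.exists_subset_le_half (hμ : NonAtomic μ) {s : Set A} (hs : MeasurableSet s)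
    (h0 : 0 < μ.real s) :
    ∃ t, MeasurableSet t ∧ t ⊆ s ∧ 0 < μ.real t ∧ μ.real t ≤ μ.real s / 2 := by
  obtain ⟨t, ht, hts, ht0, hlt⟩ := hμ s hs (by
    rw [measureReal_def] at h0; exact (ENNReal.toReal_pos_iff.1 h0).1)
  have ht0' : 0 < μ.real t := ENNReal.toReal_pos ht0.ne' (measure_ne_top _ _)
  have hlt' : μ.real t < μ.real s :=
    (ENNReal.toReal_lt_toReal (measure_ne_top _ _) (measure_ne_top _ _)).2 hlt
  have hd : μ.real (s \ t) = μ.real s - μ.real t := measureReal_sdiff hts ht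
  by_cases h : μ.real t ≤ μ.real s / 2
  · exact ⟨t, ht, hts, ht0', h⟩
  · exact ⟨s \ t, hs.diff ht, Set.sdiff_subset, by linarith, by linarith⟩

theorem NonAtomic.exists_subset_lt (hμ : NonAtomic μ) {s : Set A} (hs : MeasurableSet s)
    (h0 : 0 < μ.real s) {ε : ℝ} (hε : 0 < ε) :
    ∃ t, MeasurableSet t ∧ t ⊆ s ∧ 0 < μ.real t ∧ μ.real t < ε := by
  have key : ∀ n : ℕ, ∃ t, MeasurableSet t ∧ t ⊆ s ∧ 0 < μ.real t ∧
      μ.real t ≤ μ.real s * (1 / 2) ^ n := by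
    intro n
    induction n with
    | zero => exact ⟨s, hs, subset_rfl, h0, by simp⟩
    | succ n ih =>
      obtain ⟨t, ht, hts, ht0, hle⟩ := ih
      obtain ⟨u, hu, hut, hu0, hule⟩ := hμ.exists_subset_le_half ht ht0
      exact ⟨u, hu, hut.trans hts, hu0, by rw [pow_succ]; linarith⟩
  obtain ⟨n, hn⟩ := exists_pow_lt_of_lt_one (div_pos hε h0) (by norm_num : (1 / 2 : ℝ) < 1)
  obtain ⟨t, ht, hts, ht0, hle⟩ := key n
  refine ⟨t, ht, hts, ht0, hle.trans_lt ?_⟩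
  rw [lt_div_iff₀ h0] at hn
  linarith

/-- Sierpiński's theorem: a finite non-atomic measure takes all intermediate values. -/
theorem NonAtomic.exists_subset_measureReal_eq (hμ : NonAtomic μ) {s : Set A}
    (hs : MeasurableSet s) {c : ℝ} (hc0 : 0 ≤ c) (hc : c ≤ μ.real s) :
    ∃ t, MeasurableSet t ∧ t ⊆ s ∧ μ.real t = c := by
  let F := {t : Set A // MeasurableSet t ∧ t ⊆ s ∧ μ.real t ≤ c}
  -- Greedy exhaustion: each stage picks an admissible superset that is maximal in measure up to `(1
  -- / 2) ^ n`.
  have step : ∀ (n : ℕ) (t : F), ∃ u : F, t.1 ⊆ u.1 ∧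
      ∀ v : F, t.1 ⊆ v.1 → μ.real v.1 ≤ μ.real u.1 + (1 / 2) ^ n := by
    intro n t
    let S : Set ℝ := {x | ∃ u : F, t.1 ⊆ u.1 ∧ μ.real u.1 = x}
    have hSb : BddAbove S := ⟨c, by rintro _ ⟨u, -, rfl⟩; exact u.2.2.2⟩
    have hSn : S.Nonempty := ⟨_, t, subset_rfl, rfl⟩
    obtain ⟨_, ⟨u, htu, rfl⟩, hu⟩ :=
      exists_lt_of_lt_csSup hSn (sub_lt_self (sSup S) (by positivity : (0 : ℝ) < (1 / 2) ^ n))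
    refine ⟨u, htu, fun v hv => ?_⟩
    have := le_csSup hSb ⟨v, hv, rfl⟩
    linarith
  choose next hnext hmax using step
  let u : ℕ → F := fun n =>
    Nat.rec ⟨∅, MeasurableSet.empty, Set.empty_subset _, by simpa using hc0⟩ (fun n t => next n t) n
  have hmono : Monotone fun n => (u n).1 := monotone_nat_of_le_succ fun n => hnext n (u n)
  let T := ⋃ n, (u n).1
  have hT : MeasurableSet T := MeasurableSet.iUnion fun n => (u n).2.1
  have hTs : T ⊆ s := Set.iUnion_subset fun n => (u n).2.2.1
  have hlim : Filter.Tendsto (fun n => μ.real (u n).1) Filter.atTop (nhds (μ.real T)) :=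
    (ENNReal.tendsto_toReal (measure_ne_top _ _)).comp (tendsto_measure_iUnion_atTop hmono)
  have hTc : μ.real T ≤ c := le_of_tendsto' hlim fun n => (u n).2.2.2
  refine ⟨T, hT, hTs, hTc.antisymm (not_lt.1 fun hlt => ?_)⟩
  have hd : μ.real (s \ T) = μ.real s - μ.real T := measureReal_sdiff hTs hT
  -- A piece `r` smaller than the missing mass keeps `T ∪ r` admissible, so it competes at every
  -- stage `n`; this forces its measure below every `(1 / 2) ^ n`.
  obtain ⟨r, hr, hrs, hr0, hrlt⟩ :=
    hμ.exists_subset_lt (hs.diff hT) (by linarith) (sub_pos.2 hlt)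
  have hun : μ.real (T ∪ r) = μ.real T + μ.real r :=
    measureReal_union (Set.disjoint_left.2 fun x hx hxr => (hrs hxr).2 hx) hr
  let v : F := ⟨T ∪ r, hT.union hr, Set.union_subset hTs (hrs.trans Set.sdiff_subset), by linarith⟩
  have hv : ∀ n, μ.real T + μ.real r ≤ μ.real T + (1 / 2) ^ n := by
    intro n
    have h1 := hmax n (u n) v
      ((Set.subset_iUnion (fun n => (u n).1) n).trans Set.subset_union_left)
    have h2 : μ.real (next n (u n)).1 ≤ μ.real T :=
      measureReal_mono (Set.subset_iUnion (fun n => (u n).1) (n + 1))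
    have h3 : μ.real v.1 = μ.real T + μ.real r := hun
    linarith
  obtain ⟨n, hn⟩ := exists_pow_lt_of_lt_one hr0 (by norm_num : (1 / 2 : ℝ) < 1)
  linarith [hv n]

variable {E : Type*} [NormedAddCommGroup E] [NormedSpace ℝ E]

/-- Sierpiński cuts each fibre of `f` in the proportion `c`; the union of the pieces works exactly.
-/
theorem NonAtomic.exists_setIntegral_simpleFunc_eq (hμ : NonAtomic μ) [CompleteSpace E]
    (f : SimpleFunc A E) {c : ℝ} (hc0 : 0 ≤ c) (hc1 : c ≤ 1) :
    ∃ s, MeasurableSet s ∧ ∫ a in s, f a ∂μ = c • ∫ a, f a ∂μ := by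
  have hex : ∀ y : E, ∃ t, MeasurableSet t ∧ t ⊆ f ⁻¹' {y} ∧
      μ.real t = c * μ.real (f ⁻¹' {y}) := fun y =>
    hμ.exists_subset_measureReal_eq (f.measurableSet_fiber y)
      (mul_nonneg hc0 measureReal_nonneg) (mul_le_of_le_one_left measureReal_nonneg hc1)
  choose t ht hts hmt using hex
  have hs : MeasurableSet (⋃ y ∈ f.range, t y) :=
    Finset.measurableSet_biUnion _ fun y _ => ht y
  refine ⟨_, hs, ?_⟩
  have hf : ∀ ν : Measure A, IsFiniteMeasure ν → Integrable f ν := fun ν _ =>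
    f.integrable_of_isFiniteMeasure
  rw [SimpleFunc.integral_eq_sum _ (hf _ inferInstance),
    SimpleFunc.integral_eq_sum _ (hf _ inferInstance), Finset.smul_sum]
  refine Finset.sum_congr rfl fun y hy => ?_
  rw [measureReal_restrict_apply (f.measurableSet_fiber y), smul_smul, ← hmt]
  congr 2
  ext a
  simp only [Set.mem_inter_iff, Set.mem_preimage, Set.mem_singleton_iff, Set.mem_iUnion]
  constructor
  · rintro ⟨h, z, hz, haz⟩
    -- Pieces stay inside their own fibres, so the union meets the fibre over `y` only in `t y`.
    have : f a = z := hts z haz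
    rwa [← h, this]
  · exact fun h => ⟨hts y h, y, hy, h⟩

/-- An approximate form of Lyapunov's convexity theorem, for vector measures with a density. -/
theorem NonAtomic.exists_setIntegral_near (hμ : NonAtomic μ) [CompleteSpace E] {f : A → E}
    (hf : Integrable f μ) {c : ℝ} (hc0 : 0 ≤ c) (hc1 : c ≤ 1) {ε : ℝ} (hε : 0 < ε) :
    ∃ s, MeasurableSet s ∧ ‖∫ a in s, f a ∂μ - c • ∫ a, f a ∂μ‖ < ε := by
  obtain ⟨g, hg, hgm⟩ := (memLp_one_iff_integrable.2 hf).exists_simpleFunc_eLpNorm_sub_lt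
    ENNReal.one_ne_top (ε := ENNReal.ofReal (ε / 2)) (by simpa using hε)
  have hgi : Integrable g μ := memLp_one_iff_integrable.1 hgm
  have hd : ∫ a, ‖f a - g a‖ ∂μ < ε / 2 := by
    rw [eLpNorm_one_eq_lintegral_enorm] at hg
    change ∫ a, ‖(f - ⇑g) a‖ ∂μ < _
    rw [integral_norm_eq_lintegral_enorm (hf.sub hgi).aestronglyMeasurable]
    exact (ENNReal.lt_ofReal_iff_toReal_lt hg.ne_top).1 hg
  obtain ⟨s, hs, hsg⟩ := hμ.exists_setIntegral_simpleFunc_eq g hc0 hc1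
  refine ⟨s, hs, ?_⟩
  have h1 : ‖∫ a in s, (f a - g a) ∂μ‖ ≤ ∫ a, ‖f a - g a‖ ∂μ :=
    (norm_integral_le_integral_norm _).trans
      (setIntegral_le_integral (hf.sub hgi).norm (ae_of_all _ fun _ => norm_nonneg _))
  have h2 : ‖c • ∫ a, (f a - g a) ∂μ‖ ≤ ∫ a, ‖f a - g a‖ ∂μ := by
    rw [norm_smul, Real.norm_of_nonneg hc0]
    exact (mul_le_of_le_one_left (norm_nonneg _) hc1).trans (norm_integral_le_integral_norm _)
  -- The simple part cancels exactly by `hsg`; only the approximation error `f - g` remains, counted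
  -- twice.
  have h3 : ∫ a in s, f a ∂μ - c • ∫ a, f a ∂μ =
      ∫ a in s, (f a - g a) ∂μ - c • ∫ a, (f a - g a) ∂μ := by
    rw [integral_sub hf.integrableOn hgi.integrableOn, integral_sub hf hgi, hsg, smul_sub]
    abel
  rw [h3]
  exact (norm_sub_le _ _).trans_lt (by linarith)

end NonAtomic

end RiskSharing

namespace RiskSharing

/-! ### Integral infimal convolution of Lipschitz functions on a finite-dimensional space. -/

section Abstract

variable {A : Type*} [MeasurableSpace A] {μ : Measure A}
variable {V : Type*} [NormedAddCommGroup V]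

theorem abs_sub_le_of_lipschitzWith_one {f : V → ℝ} (hf : LipschitzWith 1 f) (x y : V) :
    |f x - f y| ≤ ‖x - y‖ := by
  simpa [Real.dist_eq, dist_eq_norm] using hf.dist_le_mul x y

/-- The two integrands differ by at most `‖X a - X' a‖`, so one reference allocation controls all
the others. -/
theorem integrable_comp_of_lipschitz {F : A → V → ℝ} (hF : ∀ a, LipschitzWith 1 (F a))
    (hFm : ∀ X : A → V, StronglyMeasurable X → Measurable fun a => F a (X a))
    {X X' : A → V} (hX : Integrable X μ) (hX' : Integrable X' μ)
    (hXm : StronglyMeasurable X) (hFX' : Integrable (fun a => F a (X' a)) μ) :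
    Integrable (fun a => F a (X a)) μ := by
  refine ((hX.sub hX').norm.add hFX'.norm).mono' (hFm X hXm).aestronglyMeasurable
    (ae_of_all _ fun a => ?_)
  have := abs_sub_le_of_lipschitzWith_one (hF a) (X a) (X' a)
  have h2 := abs_sub_abs_le_abs_sub (F a (X a)) (F a (X' a))
  simp only [Pi.add_apply, Pi.sub_apply, Real.norm_eq_abs]
  linarith

variable [NormedSpace ℝ V]

open Classical in
theorem integral_piecewise_eq_setIntegral_sub_add {s : Set A} (hs : MeasurableSet s)
    {f g : A → V} (hf : Integrable f μ) (hg : Integrable g μ) :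
    ∫ a, s.piecewise f g a ∂μ = ∫ a in s, (f a - g a) ∂μ + ∫ a, g a ∂μ := by
  rw [integral_piecewise hs hf.integrableOn hg.integrableOn,
    integral_sub hf.integrableOn hg.integrableOn, ← integral_add_compl hs hg]
  abel

variable [IsFiniteMeasure μ] [FiniteDimensional ℝ V]

/-- The correction `v` is spread evenly over all agents; the Lipschitz bound prices it at no more
than `‖v‖`. -/
theorem exists_shift {F : A → V → ℝ} (hF : ∀ a, LipschitzWith 1 (F a))
    (hFi : ∀ X : A → V, StronglyMeasurable X → Integrable X μ →
      Integrable (fun a => F a (X a)) μ)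
    (hμ0 : 0 < μ.real Set.univ) {X : A → V} (hXm : StronglyMeasurable X) (hX : Integrable X μ)
    (v : V) :
    ∃ X' : A → V, StronglyMeasurable X' ∧ Integrable X' μ ∧ ∫ a, X' a ∂μ = ∫ a, X a ∂μ + v ∧
      ∫ a, F a (X' a) ∂μ ≤ ∫ a, F a (X a) ∂μ + ‖v‖ := by
  have : CompleteSpace V := FiniteDimensional.complete ℝ V
  set w : V := (μ.real Set.univ)⁻¹ • v with hw
  have hm : StronglyMeasurable fun a => X a + w := hXm.add stronglyMeasurable_const
  have hi : Integrable (fun a => X a + w) μ := hX.add (integrable_const w)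
  refine ⟨_, hm, hi, ?_, ?_⟩
  · rw [integral_add hX (integrable_const w), integral_const, hw, smul_smul,
      mul_inv_cancel₀ hμ0.ne', one_smul]
  · have hle : ∫ a, F a (X a + w) ∂μ ≤ ∫ a, (F a (X a) + ‖w‖) ∂μ := by
      refine integral_mono (hFi _ hm hi) ((hFi _ hXm hX).add (integrable_const _)) fun a => ?_
      have := (abs_le.1 (abs_sub_le_of_lipschitzWith_one (hF a) (X a + w) (X a))).2
      simp only [add_sub_cancel_left] at this
      simp only
      linarith
    rw [integral_add (hFi _ hXm hX) (integrable_const _), integral_const, hw, norm_smul,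
      norm_inv, Real.norm_of_nonneg hμ0.le, smul_eq_mul, mul_inv_cancel_left₀ hμ0.ne'] at hle
    exact hle

/-- Approximate Lyapunov is applied to the joint density of the differences in allocation and in
cost. Agents in the resulting set follow `X₁`, the others `X₂`. -/
theorem NonAtomic.exists_near_convexCombination (hμ : NonAtomic μ) {F : A → V → ℝ}
    (hFi : ∀ X : A → V, StronglyMeasurable X → Integrable X μ →
      Integrable (fun a => F a (X a)) μ)
    {X₁ X₂ : A → V} (h₁m : StronglyMeasurable X₁) (h₁ : Integrable X₁ μ)
    (h₂m : StronglyMeasurable X₂) (h₂ : Integrable X₂ μ) {b c : ℝ} (hb : 0 ≤ b) (hc : 0 ≤ c)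
    (hbc : b + c = 1) {ε : ℝ} (hε : 0 < ε) :
    ∃ X : A → V, StronglyMeasurable X ∧ Integrable X μ ∧
      ‖∫ a, X a ∂μ - (b • ∫ a, X₁ a ∂μ + c • ∫ a, X₂ a ∂μ)‖ < ε ∧
      ∫ a, F a (X a) ∂μ < b * ∫ a, F a (X₁ a) ∂μ + c * ∫ a, F a (X₂ a) ∂μ + ε := by
  classical
  have : CompleteSpace V := FiniteDimensional.complete ℝ V
  have hF₁ := hFi _ h₁m h₁
  have hF₂ := hFi _ h₂m h₂
  have hf : Integrable (fun a => (X₁ a - X₂ a, F a (X₁ a) - F a (X₂ a))) μ :=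
    (h₁.sub h₂).prodMk (hF₁.sub hF₂)
  obtain ⟨s, hs, hsn⟩ := hμ.exists_setIntegral_near hf hb (by linarith) hε
  have hm : StronglyMeasurable (s.piecewise X₁ X₂) := h₁m.piecewise hs h₂m
  have hi : Integrable (s.piecewise X₁ X₂) μ :=
    Integrable.piecewise hs h₁.integrableOn h₂.integrableOn
  have hFp : (fun a => F a (s.piecewise X₁ X₂ a)) =
      s.piecewise (fun a => F a (X₁ a)) (fun a => F a (X₂ a)) := by
    ext a
    by_cases h : a ∈ s <;> simp [h]
  obtain rfl : c = 1 - b := by linarith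
  have hX12 : Integrable (fun a => X₁ a - X₂ a) μ := h₁.sub h₂
  have hF12 : Integrable (fun a => F a (X₁ a) - F a (X₂ a)) μ := hF₁.sub hF₂
  rw [integral_pair hX12.integrableOn hF12.integrableOn, integral_pair hX12 hF12,
    Prod.smul_mk, Prod.mk_sub_mk, Prod.norm_def, max_lt_iff] at hsn
  obtain ⟨hn₁, hn₂⟩ := hsn
  refine ⟨_, hm, hi, ?_, ?_⟩
  · rw [integral_sub h₁ h₂] at hn₁
    rw [integral_piecewise_eq_setIntegral_sub_add hs h₁ h₂]
    refine lt_of_eq_of_lt (congrArg norm ?_) hn₁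
    module
  · rw [integral_sub hF₁ hF₂, Real.norm_eq_abs, smul_eq_mul] at hn₂
    rw [hFp, integral_piecewise_eq_setIntegral_sub_add hs hF₁ hF₂]
    have := (abs_lt.1 hn₂).2
    linarith

/-- If the integral infimal convolution of a family of Lipschitz functions is bounded below at one
point, it has an affine minorant. -/
theorem NonAtomic.exists_affine_minorant (hμ : NonAtomic μ) (hμ0 : 0 < μ.real Set.univ)
    {F : A → V → ℝ} (hF : ∀ a, LipschitzWith 1 (F a))
    (hFi : ∀ X : A → V, StronglyMeasurable X → Integrable X μ →
      Integrable (fun a => F a (X a)) μ)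
    {z₀ : V} {m : ℝ} (hz₀ : ∀ X : A → V, StronglyMeasurable X → Integrable X μ →
      ∫ a, X a ∂μ = z₀ → m ≤ ∫ a, F a (X a) ∂μ) :
    ∃ g : V →L[ℝ] ℝ, ∀ X : A → V, StronglyMeasurable X → Integrable X μ →
      m + g (∫ a, X a ∂μ - z₀) ≤ ∫ a, F a (X a) ∂μ := by
  -- The strict epigraph of the convolution; strictness leaves room for the error terms.
  let U : Set (V × ℝ) := {p | ∃ X : A → V, StronglyMeasurable X ∧ Integrable X μ ∧
    ∫ a, X a ∂μ = p.1 ∧ ∫ a, F a (X a) ∂μ < p.2}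
  have hUo : IsOpen U := by
    rw [Metric.isOpen_iff]
    rintro ⟨z, t⟩ ⟨X, hXm, hX, hXz, hXt⟩
    simp only at hXz hXt
    refine ⟨(t - ∫ a, F a (X a) ∂μ) / 2, by linarith, ?_⟩
    rintro ⟨z', t'⟩ hzt
    rw [Metric.mem_ball, Prod.dist_eq, max_lt_iff, dist_eq_norm, Real.dist_eq] at hzt
    obtain ⟨h1, h2⟩ := hzt
    obtain ⟨X', hm', hi', hI, hle⟩ := exists_shift hF hFi hμ0 hXm hX (z' - z)
    refine ⟨X', hm', hi', by rw [hI, hXz]; simp, ?_⟩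
    have := (abs_lt.1 h2).1
    simp only at this h1 ⊢
    linarith
  have hUc : Convex ℝ U := by
    rintro ⟨z₁, t₁⟩ ⟨X₁, h₁m, h₁, rfl, h₁t⟩ ⟨z₂, t₂⟩ ⟨X₂, h₂m, h₂, rfl, h₂t⟩ b c hb hc hbc
    simp only at h₁t h₂t
    set I₁ := ∫ a, F a (X₁ a) ∂μ
    set I₂ := ∫ a, F a (X₂ a) ∂μ
    have hpos : 0 < b * (t₁ - I₁) + c * (t₂ - I₂) := by
      rcases hb.eq_or_lt with rfl | hb'
      · obtain rfl : c = 1 := by linarith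
        linarith
      · have := mul_pos hb' (sub_pos.2 h₁t)
        have := mul_nonneg hc (sub_pos.2 h₂t).le
        linarith
    -- Half of the slack absorbs the cost error of the mixture, the other half the shift restoring
    -- the exact total.
    obtain ⟨X, hXm, hX, hn, hlt⟩ :=
      hμ.exists_near_convexCombination hFi h₁m h₁ h₂m h₂ hb hc hbc (half_pos hpos)
    obtain ⟨X', hm', hi', hI, hle⟩ := exists_shift hF hFi hμ0 hXm hX
      (-(∫ a, X a ∂μ - (b • ∫ a, X₁ a ∂μ + c • ∫ a, X₂ a ∂μ)))
    refine ⟨X', hm', hi', ?_, ?_⟩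
    · rw [hI]
      simp
    · rw [norm_neg] at hle
      simp only [Prod.smul_mk, Prod.mk_add_mk, smul_eq_mul]
      linarith
  have hnot : (z₀, m) ∉ U := fun ⟨X, hXm, hX, hXz, hXt⟩ => hXt.not_ge (hz₀ X hXm hX hXz)
  obtain ⟨f, hf⟩ := geometric_hahn_banach_open_point hUc hUo hnot
  have hfs : ∀ z t, f (z, t) = f (z, 0) + t * f (0, 1) := by
    intro z t
    rw [← smul_eq_mul, ← map_smul, ← map_add]
    simp
  -- The hyperplane is not vertical: `U` has a point straight above `(z₀, m)`, and `f` is smaller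
  -- there.
  have hs : f (0, 1) < 0 := by
    obtain ⟨X, hXm, hX, hXz, -⟩ := exists_shift hF hFi hμ0
      (stronglyMeasurable_const (b := (0 : V))) (integrable_const 0) z₀
    have hXz' : ∫ a, X a ∂μ = z₀ := by simpa using hXz
    have h1 : m < ∫ a, F a (X a) ∂μ + 1 := by linarith [hz₀ X hXm hX hXz']
    have h2 := hf (z₀, ∫ a, F a (X a) ∂μ + 1) ⟨X, hXm, hX, hXz', by simp⟩
    rw [hfs, hfs z₀ m] at h2
    by_contra! h3
    nlinarith
  refine ⟨(-f (0, 1))⁻¹ • f.comp (ContinuousLinearMap.inl ℝ V ℝ), fun X hXm hX => ?_⟩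
  set I := ∫ a, F a (X a) ∂μ
  set z := ∫ a, X a ∂μ
  have hsub : f (z - z₀, 0) = f (z, 0) - f (z₀, 0) := by
    rw [← map_sub]
    simp
  have hle : f (z - z₀, 0) ≤ (I - m) * (-f (0, 1)) := by
    refine le_of_forall_pos_lt_add fun ε hε => ?_
    -- The point `(z, I)` itself is not known to lie in `U`, so it is approached from above.
    have h2 := hf (z, I + ε / (-f (0, 1)))
      ⟨X, hXm, hX, rfl, lt_add_of_pos_right _ (div_pos hε (neg_pos.2 hs))⟩
    rw [hfs, hfs z₀ m, add_mul] at h2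
    have h3 : ε / (-f (0, 1)) * f (0, 1) = -ε := by
      rw [div_neg, neg_mul, div_mul_cancel₀ _ hs.ne]
    rw [hsub]
    linarith
  have : (-f (0, 1))⁻¹ * f (z - z₀, 0) ≤ I - m := by
    rw [inv_mul_le_iff₀ (neg_pos.2 hs)]
    linarith
  simp only [smul_apply, ContinuousLinearMap.comp_apply,
    ContinuousLinearMap.inl_apply, smul_eq_mul]
  linarith

/-- If the conjugates of a measurable family of Lipschitz functions are infinite at `g` for every
agent, then so is the conjugate of its integral infimal convolution. -/
theorem exists_integral_sub_gt_of_unbounded (hμ0 : 0 < μ.real Set.univ)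
    {F : A → V → ℝ} (hF : ∀ a, LipschitzWith 1 (F a))
    (hFm : ∀ X : A → V, StronglyMeasurable X → Measurable fun a => F a (X a))
    (hFi : ∀ X : A → V, StronglyMeasurable X → Integrable X μ →
      Integrable (fun a => F a (X a)) μ)
    (g : V →L[ℝ] ℝ) (hg : ∀ a (N : ℝ), ∃ x, N < g x - F a x) (C : ℝ) :
    ∃ X : A → V, StronglyMeasurable X ∧ Integrable X μ ∧
      C < g (∫ a, X a ∂μ) - ∫ a, F a (X a) ∂μ := by
  classical
  borelize V
  have : CompleteSpace V := FiniteDimensional.complete ℝ V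
  have : ProperSpace V := FiniteDimensional.proper ℝ V
  set M := μ.real Set.univ
  have hF0 : Integrable (fun a => F a 0) μ :=
    hFi _ (stronglyMeasurable_const (b := (0 : V))) (integrable_const 0)
  set K := ∫ a, |F a 0| ∂μ
  have hK : 0 ≤ K := integral_nonneg fun _ => abs_nonneg _
  -- A gain `N` on a set of measure above `M / 2` totals at least `|C| + K + 1`, where `K` covers
  -- the cost of the zero position.
  set N := 2 * (|C| + K + 1) / M with hN
  have hN0 : 0 ≤ N := by positivity
  let q := TopologicalSpace.denseSeq V
  -- Continuity moves the near-maximizer into a countable dense set, where taking the least index is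
  -- a measurable selection.
  have hex : ∀ a, ∃ k, N < g (q k) - F a (q k) := by
    intro a
    obtain ⟨x, hx⟩ := hg a N
    have ho : IsOpen {x | N < g x - F a x} :=
      isOpen_lt continuous_const (g.continuous.sub (hF a).continuous)
    obtain ⟨_, hy, ⟨k, rfl⟩⟩ :=
      (TopologicalSpace.denseRange_denseSeq V).inter_open_nonempty _ ho ⟨x, hx⟩
    exact ⟨k, hy⟩
  let k : A → ℕ := fun a => Nat.find (hex a)
  have hk : Measurable k := measurable_find hex fun n =>
    measurableSet_lt measurable_const
      (measurable_const.sub (hFm (fun _ => q n) stronglyMeasurable_const))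
  have hkspec : ∀ a, N < g (q (k a)) - F a (q (k a)) := fun a => Nat.find_spec (hex a)
  -- On `D n` the selection takes finitely many values, hence is bounded; agents outside receive
  -- `0`.
  let D : ℕ → Set A := fun n => {a | k a ≤ n}
  have hD : ∀ n, MeasurableSet (D n) := fun n => hk measurableSet_Iic
  have hDmono : Monotone D := fun i j hij a (ha : k a ≤ i) => le_trans ha hij
  have hDu : ⋃ n, D n = Set.univ :=
    Set.eq_univ_of_forall fun a => Set.mem_iUnion.2 ⟨k a, le_refl (k a)⟩
  have hlim : Filter.Tendsto (fun n => μ.real (D n)) Filter.atTop (nhds M) := by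
    have := (ENNReal.tendsto_toReal (measure_ne_top μ _)).comp
      (tendsto_measure_iUnion_atTop (μ := μ) hDmono)
    rwa [hDu] at this
  obtain ⟨n, hn⟩ := (hlim.eventually_const_lt (half_lt_self hμ0)).exists
  have hqk : StronglyMeasurable fun a => q (k a) :=
    ((measurable_from_top (f := q)).comp hk).stronglyMeasurable
  let X : A → V := (D n).indicator fun a => q (k a)
  have hXm : StronglyMeasurable X := hqk.indicator (hD n)
  have hX : Integrable X μ := by
    refine Integrable.of_bound hXm.aestronglyMeasurable (∑ j ∈ Finset.range (n + 1), ‖q j‖)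
      (ae_of_all _ fun a => ?_)
    by_cases ha : a ∈ D n
    · simp only [X, Set.indicator_of_mem ha]
      exact Finset.single_le_sum (f := fun j => ‖q j‖) (fun _ _ => norm_nonneg _)
        (Finset.mem_range.2 (Nat.lt_succ_of_le ha))
    · simp only [X, Set.indicator_of_notMem ha, norm_zero]
      positivity
  refine ⟨X, hXm, hX, ?_⟩
  have hFX := hFi X hXm hX
  have hgX : Integrable (fun a => g (X a)) μ := g.integrable_comp hX
  have hNi : Integrable ((D n).indicator fun _ => N) μ := (integrable_const N).indicator (hD n)
  have hlow : ∫ a, ((D n).indicator (fun _ => N) a - |F a 0|) ∂μ ≤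
      ∫ a, (g (X a) - F a (X a)) ∂μ := by
    refine integral_mono (hNi.sub hF0.abs) (hgX.sub hFX) fun a => ?_
    by_cases ha : a ∈ D n
    · simp only [X, Set.indicator_of_mem ha]
      linarith [hkspec a, abs_nonneg (F a 0)]
    · simp only [X, Set.indicator_of_notMem ha, map_zero]
      linarith [le_abs_self (F a 0)]
  rw [integral_sub hNi hF0.abs, integral_sub hgX hFX, integral_indicator_const _ (hD n),
    g.integral_comp_comm hX, smul_eq_mul] at hlow
  have h2 : |C| + K + 1 ≤ μ.real (D n) * N := by
    have : M / 2 * N = |C| + K + 1 := by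
      rw [hN]
      field_simp
    rw [← this]
    gcongr
  linarith [le_abs_self C]

end Abstract

end RiskSharing

namespace RiskSharing

/-! ### Finite-dimensionality of `L^∞` over a finite σ-algebra. -/

section FiniteSigmaAlgebra

variable {Ω : Type*} [MeasurableSpace Ω] {P : Measure Ω}

theorem finite_range_of_finite_measurableSet (hF : {s : Set Ω | MeasurableSet s}.Finite)
    {f : Ω → ℝ} (hf : Measurable f) : (Set.range f).Finite := by
  have hinj : Set.InjOn (fun y : ℝ => f ⁻¹' {y}) (Set.range f) := by
    rintro _ ⟨ω, rfl⟩ z _ h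
    have : ω ∈ f ⁻¹' {z} := h.subset rfl
    exact this
  refine Set.Finite.of_finite_image (hF.subset ?_) hinj
  rintro _ ⟨y, -, rfl⟩
  exact hf (measurableSet_singleton y)

theorem toLp_simpleFunc_mem_span_indicator [IsFiniteMeasure P] (f : SimpleFunc Ω ℝ)
    (hf : MemLp f ∞ P) :
    hf.toLp f ∈ Submodule.span ℝ (Set.range fun B : {s : Set Ω // MeasurableSet s} =>
      indicatorConstLp ∞ B.2 (measure_ne_top P _) (1 : ℝ)) := by
  induction f using SimpleFunc.induction with
  | const c hs =>
    rename_i s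
    have : hf.toLp _ = c • indicatorConstLp ∞ hs (measure_ne_top P _) (1 : ℝ) := by
      apply Lp.ext
      filter_upwards [hf.coeFn_toLp, Lp.coeFn_smul c
        (indicatorConstLp ∞ hs (measure_ne_top P _) (1 : ℝ)),
        indicatorConstLp_coeFn (p := ∞) (hs := hs) (hμs := measure_ne_top P _) (c := (1 : ℝ))]
        with ω h1 h2 h3
      rw [h1, h2, Pi.smul_apply, h3]
      by_cases h : ω ∈ s <;> simp [h]
    rw [this]
    exact Submodule.smul_mem _ _ (Submodule.subset_span ⟨⟨s, hs⟩, rfl⟩)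
  | add hd h1 h2 =>
    rename_i f g
    have hf' : MemLp f ∞ P := f.memLp_top P
    have hg' : MemLp g ∞ P := g.memLp_top P
    have : hf.toLp _ = hf'.toLp f + hg'.toLp g := rfl
    rw [this]
    exact Submodule.add_mem _ (h1 hf') (h2 hg')

/-- Every measurable function is simple here, so the finitely many indicators span. -/
theorem finiteDimensional_Lp_top [IsFiniteMeasure P]
    (hF : {s : Set Ω | MeasurableSet s}.Finite) : FiniteDimensional ℝ (Lp ℝ ∞ P) := by
  have : Finite {s : Set Ω // MeasurableSet s} := hF.to_subtype
  refine ⟨Submodule.fg_def.2 ⟨_, Set.finite_range fun B : {s : Set Ω // MeasurableSet s} =>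
    indicatorConstLp ∞ B.2 (measure_ne_top P _) (1 : ℝ), ?_⟩⟩
  rw [eq_top_iff]
  intro X _
  have hm : Measurable X := (Lp.stronglyMeasurable X).measurable
  let f : SimpleFunc Ω ℝ :=
    ⟨X, fun y => hm (measurableSet_singleton y), finite_range_of_finite_measurableSet hF hm⟩
  have hf : MemLp f ∞ P := Lp.memLp X
  have : hf.toLp f = X := Lp.toLp_coeFn X hf
  rw [← this]
  exact toLp_simpleFunc_mem_span_indicator f hf

end FiniteSigmaAlgebra

/-! ### Duality on `L^∞`, densities and the Lipschitz property. -/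

section Pairing

variable {Ω : Type*} [MeasurableSpace Ω] {P : Measure Ω}

theorem integrable_pairing (X : Lp ℝ ∞ P) (Y : Lp ℝ 1 P) : Integrable (fun ω => X ω * Y ω) P :=
  (Lp.memLp X).integrable_mul (Lp.memLp Y)

/-- The pairing with a fixed element of `L^1(P)`, as a linear functional. -/
noncomputable def pairingₗ (Y : Lp ℝ 1 P) : Lp ℝ ∞ P →ₗ[ℝ] ℝ where
  toFun X := pairing X Y
  map_add' X X' := by
    unfold pairing
    rw [← integral_add (integrable_pairing X Y) (integrable_pairing X' Y)]
    refine integral_congr_ae ?_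
    filter_upwards [Lp.coeFn_add X X'] with ω h
    rw [h, Pi.add_apply, add_mul]
  map_smul' c X := by
    unfold pairing
    rw [RingHom.id_apply, smul_eq_mul, ← integral_const_mul]
    refine integral_congr_ae ?_
    filter_upwards [Lp.coeFn_smul c X] with ω h
    rw [h, Pi.smul_apply, smul_eq_mul, mul_assoc]

theorem ae_norm_le_norm_Lp_top (X : Lp ℝ ∞ P) : ∀ᵐ ω ∂P, ‖X ω‖ ≤ ‖X‖ := by
  filter_upwards [ae_le_eLpNormEssSup (f := X) (μ := P)] with ω h
  rw [Lp.norm_def, eLpNorm_exponent_top, ← toReal_enorm]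
  exact ENNReal.toReal_mono (by simpa using (Lp.memLp X).2.ne) h

variable [IsFiniteMeasure P]

/-- The bilinear form `E^P(X Y)` on `L^∞(P)`. -/
noncomputable def pairingForm : Lp ℝ ∞ P →ₗ[ℝ] Module.Dual ℝ (Lp ℝ ∞ P) where
  toFun Y := pairingₗ (((Lp.memLp Y).mono_exponent le_top).toLp Y)
  map_add' Y Y' := by
    ext X
    change pairing _ _ = pairing _ _ + pairing _ _
    unfold pairing
    rw [← integral_add (integrable_pairing _ _) (integrable_pairing _ _)]
    refine integral_congr_ae ?_
    filter_upwards [Lp.coeFn_add Y Y',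
      (((Lp.memLp Y).mono_exponent (p := 1) le_top)).coeFn_toLp,
      (((Lp.memLp Y').mono_exponent (p := 1) le_top)).coeFn_toLp,
      (((Lp.memLp (Y + Y')).mono_exponent (p := 1) le_top)).coeFn_toLp] with ω h h1 h2 h3
    rw [h1, h2, h3, h, Pi.add_apply, mul_add]
  map_smul' c Y := by
    ext X
    change pairing _ _ = c * pairing _ _
    unfold pairing
    rw [← integral_const_mul]
    refine integral_congr_ae ?_
    filter_upwards [Lp.coeFn_smul c Y,
      (((Lp.memLp Y).mono_exponent (p := 1) le_top)).coeFn_toLp,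
      (((Lp.memLp (c • Y)).mono_exponent (p := 1) le_top)).coeFn_toLp] with ω h h1 h3
    rw [h1, h3, h, Pi.smul_apply, smul_eq_mul]
    ring

theorem pairingForm_apply (X Y : Lp ℝ ∞ P) : pairingForm Y X = ∫ ω, X ω * Y ω ∂P := by
  change pairing _ _ = _
  unfold pairing
  refine integral_congr_ae ?_
  filter_upwards [(((Lp.memLp Y).mono_exponent (p := 1) le_top)).coeFn_toLp] with ω h1
  rw [h1]

/-- Testing `Y` against itself gives `∫ Y² = 0`. -/
theorem pairingForm_injective : Function.Injective (pairingForm (P := P)) := by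
  rw [injective_iff_map_eq_zero]
  intro Y hY
  have h0 : ∫ ω, Y ω * Y ω ∂P = 0 := by rw [← pairingForm_apply, hY]; rfl
  have hi : Integrable (fun ω => Y ω * Y ω) P :=
    (Lp.memLp Y).integrable_mul ((Lp.memLp Y).mono_exponent (p := 1) le_top)
  rw [integral_eq_zero_iff_of_nonneg (fun ω => mul_self_nonneg _) hi] at h0
  apply Lp.ext
  filter_upwards [h0, Lp.coeFn_zero ℝ ∞ P] with ω h h'
  rw [h']
  simpa using h

/-- An injective map into a dual of the same finite dimension is onto. -/
theorem exists_pairingForm_eq (hF : {s : Set Ω | MeasurableSet s}.Finite)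
    (g : Lp ℝ ∞ P →ₗ[ℝ] ℝ) : ∃ Y : Lp ℝ ∞ P, pairingForm Y = g := by
  have := finiteDimensional_Lp_top (P := P) hF
  exact (LinearMap.injective_iff_surjective_of_finrank_eq_finrank
    Subspace.dual_finrank_eq.symm).1 pairingForm_injective g

theorem exists_pairing_eq (hF : {s : Set Ω | MeasurableSet s}.Finite)
    (g : Lp ℝ ∞ P →ₗ[ℝ] ℝ) : ∃ Y : Lp ℝ 1 P, ∀ X, pairing X Y = g X := by
  obtain ⟨Y, rfl⟩ := exists_pairingForm_eq hF g
  exact ⟨_, fun X => rfl⟩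

theorem eq_of_forall_pairing_eq (hF : {s : Set Ω | MeasurableSet s}.Finite) {X X' : Lp ℝ ∞ P}
    (h : ∀ Y : Lp ℝ 1 P, pairing X Y = pairing X' Y) : X = X' := by
  rw [← sub_eq_zero]
  refine (Module.forall_dual_apply_eq_zero_iff ℝ _).1 fun g => ?_
  obtain ⟨Y, hY⟩ := exists_pairing_eq hF g
  rw [map_sub, ← hY, ← hY, h, sub_self]

/-- A positive normalized functional on `L^∞(P)` is the expectation under some probability measure
`Q ≪ P`. -/
theorem exists_absContProbabilities_pairing_eq (hF : {s : Set Ω | MeasurableSet s}.Finite)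
    (g : Lp ℝ ∞ P →ₗ[ℝ] ℝ) (hg0 : ∀ X, 0 ≤ X → 0 ≤ g X) (hg1 : g (Lp.const ∞ P 1) = 1) :
    ∃ Y ∈ absContProbabilities P, ∀ X, pairing X Y = g X := by
  obtain ⟨Y, hY⟩ := exists_pairingForm_eq hF g
  have hYg : ∀ X, g X = ∫ ω, X ω * Y ω ∂P := fun X => by rw [← hY, pairingForm_apply]
  have hYm : Measurable Y := (Lp.stronglyMeasurable Y).measurable
  have hYi : Integrable Y P := memLp_one_iff_integrable.1 ((Lp.memLp Y).mono_exponent le_top)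
  have hY1 : ∫ ω, Y ω ∂P = 1 := by
    rw [← hg1, hYg]
    refine integral_congr_ae ?_
    filter_upwards [Lp.coeFn_const (p := ∞) (μ := P) (1 : ℝ)] with ω h
    rw [h, Function.const_apply, one_mul]
  -- Positivity of `g` on indicators makes all set integrals of `Y` nonnegative.
  have hY0 : 0 ≤ᵐ[P] Y := by
    refine ae_nonneg_of_forall_setIntegral_nonneg hYi fun s hs _ => ?_
    have h1 := hg0 (indicatorConstLp ∞ hs (measure_ne_top P s) (1 : ℝ)) (by
      rw [← Lp.coeFn_nonneg]
      filter_upwards [indicatorConstLp_coeFn (p := ∞) (hs := hs) (hμs := measure_ne_top P s)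
        (c := (1 : ℝ))] with ω h
      rw [h]
      exact Set.indicator_nonneg (fun _ _ => zero_le_one) _)
    rw [hYg] at h1
    rw [← integral_indicator hs]
    refine h1.trans_eq (integral_congr_ae ?_)
    filter_upwards [indicatorConstLp_coeFn (p := ∞) (hs := hs) (hμs := measure_ne_top P s)
        (c := (1 : ℝ))] with ω h
    rw [h]
    by_cases hω : ω ∈ s <;> simp [hω]
  refine ⟨((Lp.memLp Y).mono_exponent le_top).toLp Y,
    ⟨P.withDensity fun ω => ENNReal.ofReal (Y ω), ⟨?_⟩, withDensity_absolutelyContinuous _ _, ?_⟩,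
    fun X => by rw [← hY]; rfl⟩
  · rw [withDensity_apply _ MeasurableSet.univ, setLIntegral_univ,
      ← ofReal_integral_eq_lintegral_ofReal hYi hY0, hY1, ENNReal.ofReal_one]
  · filter_upwards [((Lp.memLp Y).mono_exponent (p := 1) le_top).coeFn_toLp,
      Measure.rnDeriv_withDensity P hYm.ennreal_ofReal, hY0] with ω h1 h2 h3
    rw [h1, h2, ENNReal.toReal_ofReal h3]

/-- Risk measures are nonexpansive. -/
theorem IsRiskMeasure.lipschitzWith {ρ : Lp ℝ ∞ P → ℝ} (hρ : IsRiskMeasure ρ) :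
    LipschitzWith 1 ρ := by
  refine LipschitzWith.of_le_add fun X Y => ?_
  -- What remains is monotonicity applied to `X ≤ Y + ‖X - Y‖`.
  rw [← hρ.cash_additive, dist_eq_norm]
  refine hρ.monotone _ _ ?_
  rw [← Lp.coeFn_le]
  filter_upwards [ae_norm_le_norm_Lp_top (X - Y), Lp.coeFn_sub X Y,
    Lp.coeFn_add Y (Lp.const ∞ P ‖X - Y‖), Lp.coeFn_const (p := ∞) (μ := P) ‖X - Y‖]
    with ω h1 h2 h3 h4
  rw [h3, Pi.add_apply, h4, Function.const_apply]
  rw [h2, Pi.sub_apply, Real.norm_eq_abs] at h1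
  linarith [le_abs_self (X ω - Y ω)]

end Pairing

/-! ### From Gelfand to Bochner integrability. -/

section Gelfand

variable {A : Type*} [MeasurableSpace A] {μ : Measure A}
variable {V : Type*} [NormedAddCommGroup V] [NormedSpace ℝ V] [FiniteDimensional ℝ V]

theorem stronglyMeasurable_of_forall_dual {X : A → V}
    (h : ∀ g : V →ₗ[ℝ] ℝ, Measurable fun a => g (X a)) : StronglyMeasurable X := by
  let b := Module.finBasis ℝ V
  have : X = fun a => ∑ i, b.coord i (X a) • b i := by
    ext a
    exact (b.sum_repr (X a)).symm
  rw [this]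
  refine Finset.stronglyMeasurable_fun_sum _ fun i _ => ?_
  exact (h (b.coord i)).stronglyMeasurable.smul_const (b i)

theorem integrable_of_forall_dual {X : A → V}
    (h : ∀ g : V →ₗ[ℝ] ℝ, Integrable (fun a => g (X a)) μ) : Integrable X μ := by
  let b := Module.finBasis ℝ V
  have : X = fun a => ∑ i, b.coord i (X a) • b i := by
    ext a
    exact (b.sum_repr (X a)).symm
  rw [this]
  exact integrable_finsetSum _ fun i _ => (h (b.coord i)).smul_const (b i)

end Gelfand

section Allocations

variable {A : Type*} [MeasurableSpace A] {μ : Measure A}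
variable {Ω : Type*} [MeasurableSpace Ω] {P : Measure Ω} [IsFiniteMeasure P]

theorem measurableAllocation_iff (hF : {s : Set Ω | MeasurableSet s}.Finite)
    {X : A → Lp ℝ ∞ P} : MeasurableAllocation X ↔ StronglyMeasurable X := by
  have := finiteDimensional_Lp_top (P := P) hF
  constructor
  · refine fun h => stronglyMeasurable_of_forall_dual fun g => ?_
    obtain ⟨Y, hY⟩ := exists_pairing_eq hF g
    simpa only [hY] using h Y
  · exact fun h Y => ((LinearMap.continuous_of_finiteDimensional
      (pairingₗ Y)).comp_stronglyMeasurable h).measurable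

/-- In finite dimension weak and strong measurability and integrability agree, and pairings separate
points. -/
theorem mem_feasibleAllocations_iff (hF : {s : Set Ω | MeasurableSet s}.Finite)
    {X : A → Lp ℝ ∞ P} {Z : Lp ℝ ∞ P} :
    X ∈ feasibleAllocations μ Z ↔
      StronglyMeasurable X ∧ Integrable X μ ∧ ∫ a, X a ∂μ = Z := by
  have := finiteDimensional_Lp_top (P := P) hF
  have hcomm : Integrable X μ → ∀ Y : Lp ℝ 1 P, pairing (∫ a, X a ∂μ) Y =
      ∫ a, pairing (X a) Y ∂μ := fun h Y =>
    ((pairingₗ Y).toContinuousLinearMap.integral_comp_comm h).symm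
  constructor
  · rintro ⟨⟨hm, hi⟩, hZ⟩
    have hX : Integrable X μ := integrable_of_forall_dual fun g => by
      obtain ⟨Y, hY⟩ := exists_pairing_eq hF g
      simpa only [hY] using hi Y
    exact ⟨(measurableAllocation_iff hF).1 hm, hX,
      eq_of_forall_pairing_eq hF fun Y => by rw [hcomm hX, hZ Y]⟩
  · rintro ⟨hm, hX, rfl⟩
    exact ⟨⟨(measurableAllocation_iff hF).2 hm, fun Y =>
      (pairingₗ Y).toContinuousLinearMap.integrable_comp hX⟩, fun Y => hcomm hX Y⟩

end Allocations

end RiskSharing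

namespace RiskSharing

/-! ### The extended integral and finiteness. -/

section ExtendedIntegral

variable {A : Type*} [MeasurableSpace A] {μ : Measure A} {f : A → ℝ}

theorem lintegral_ofReal_lt_top_of_extendedIntegral_ne_top (h : extendedIntegral μ f ≠ ⊤) :
    ∫⁻ a, ENNReal.ofReal (f a) ∂μ < ∞ := by
  by_contra hc
  exact h (if_pos (not_lt_top_iff.1 hc))

theorem integrable_of_extendedIntegral_ne_bot (hf : Measurable f)
    (hpos : ∫⁻ a, ENNReal.ofReal (f a) ∂μ < ∞) (h : extendedIntegral μ f ≠ ⊥) :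
    Integrable f μ := by
  have hneg : ∫⁻ a, ENNReal.ofReal (-f a) ∂μ < ∞ := by
    by_contra hc
    rw [not_lt_top_iff] at hc
    refine h ?_
    rw [extendedIntegral, if_neg hpos.ne, hc, EReal.coe_ennreal_top, EReal.sub_top]
  refine ⟨hf.aestronglyMeasurable, ?_⟩
  rw [HasFiniteIntegral]
  have : ∀ a, ‖f a‖ₑ = ENNReal.ofReal (f a) + ENNReal.ofReal (-f a) := fun a => by
    rw [Real.enorm_eq_ofReal_abs]
    rcases le_total 0 (f a) with h | h
    · rw [abs_of_nonneg h, ENNReal.ofReal_of_nonpos (neg_nonpos.2 h), add_zero]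
    · rw [abs_of_nonpos h, ENNReal.ofReal_of_nonpos h, zero_add]
  simp_rw [this]
  rw [lintegral_add_left hf.ennreal_ofReal]
  exact ENNReal.add_lt_top.2 ⟨hpos, hneg⟩

theorem extendedIntegral_eq_integral (hf : Integrable f μ) :
    extendedIntegral μ f = ((∫ a, f a ∂μ : ℝ) : EReal) := by
  have hpos : ∫⁻ a, ENNReal.ofReal (f a) ∂μ ≠ ∞ :=
    ((lintegral_ofReal_le_lintegral_enorm f).trans_lt hf.2).ne
  have hneg : ∫⁻ a, ENNReal.ofReal (-f a) ∂μ ≠ ∞ :=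
    ((lintegral_ofReal_le_lintegral_enorm (-f)).trans_lt hf.neg.2).ne
  rw [extendedIntegral, if_neg hpos, integral_eq_lintegral_pos_part_sub_lintegral_neg_part hf,
    EReal.coe_sub, EReal.coe_ennreal_toReal hpos, EReal.coe_ennreal_toReal hneg]

end ExtendedIntegral

/-! ### Slope of the minorant and the contradiction. -/

section Main

variable {A : Type*} [MeasurableSpace A] {μ : Measure A} [IsFiniteMeasure μ]
variable {Ω : Type*} [MeasurableSpace Ω] {P : Measure Ω}

theorem ConjugatelyDegenerate.exists_lt_pairing_sub {ρ : Lp ℝ ∞ P → ℝ}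
    (hρ : ConjugatelyDegenerate ρ) {Y : Lp ℝ 1 P} (hY : Y ∈ absContProbabilities P) (N : ℝ) :
    ∃ X, N < pairing X Y - ρ X := by
  have h : convexConjugate ρ Y = ⊤ := by
    have : convexConjugate ρ Y ∈ convexConjugate ρ '' absContProbabilities P :=
      Set.mem_image_of_mem _ hY
    rwa [hρ, Set.mem_singleton_iff] at this
  have hN : (N : EReal) < convexConjugate ρ Y := h ▸ EReal.coe_lt_top N
  obtain ⟨X, hX⟩ := lt_iSup_iff.1 hN
  exact ⟨X, EReal.coe_lt_coe_iff.1 hX⟩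

variable [IsProbabilityMeasure P]

/-- The slope of an affine minorant of the integral infimal convolution of risk measures is the
density of a probability measure. -/
theorem exists_absContProbabilities_of_affine_minorant
    (hF : {s : Set Ω | MeasurableSet s}.Finite) (hμ0 : 0 < μ.real Set.univ)
    {ρ : A → Lp ℝ ∞ P → ℝ} (hρ : ∀ a, IsRiskMeasure (ρ a))
    (hρi : ∀ X : A → Lp ℝ ∞ P, StronglyMeasurable X → Integrable X μ →
      Integrable (fun a => ρ a (X a)) μ)
    (g : Lp ℝ ∞ P →L[ℝ] ℝ) {z₀ : Lp ℝ ∞ P} {m : ℝ}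
    (hg : ∀ X : A → Lp ℝ ∞ P, StronglyMeasurable X → Integrable X μ →
      m + g (∫ a, X a ∂μ - z₀) ≤ ∫ a, ρ a (X a) ∂μ) :
    ∃ Y ∈ absContProbabilities P, ∀ X, pairing X Y = g X := by
  have := finiteDimensional_Lp_top (P := P) hF
  have : CompleteSpace (Lp ℝ ∞ P) := FiniteDimensional.complete ℝ _
  set M := μ.real Set.univ
  set K := ∫ a, ρ a 0 ∂μ
  have hci : ∀ X : Lp ℝ ∞ P, Integrable (fun a => ρ a X) μ := fun X =>
    hρi (fun _ => X) stronglyMeasurable_const (integrable_const X)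
  have hconst : ∀ X : Lp ℝ ∞ P, m + M * g X - g z₀ ≤ ∫ a, ρ a X ∂μ := fun X => by
    have h := hg (fun _ => X) stronglyMeasurable_const (integrable_const X)
    rw [integral_const, map_sub, map_smul, smul_eq_mul] at h
    linarith
  refine exists_absContProbabilities_pairing_eq hF g.toLinearMap (fun X hX => ?_) ?_
  · by_contra! hneg
    have hneg' : g X < 0 := hneg
    -- Give every agent `-(r • X)`: monotonicity keeps the total risk below `K`, while the minorant
    -- would grow linearly in `r` if `g X < 0`.
    have hb : ∀ r : ℝ, 0 ≤ r → r * (M * -g X) ≤ K - m + g z₀ := fun r hr => by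
      have h := hconst (-(r • X))
      have h2 : ∫ a, ρ a (-(r • X)) ∂μ ≤ K :=
        integral_mono (hci _) (hci 0) fun a => (hρ a).monotone _ _ (neg_nonpos.2 (by
          rw [← Lp.coeFn_nonneg] at hX ⊢
          filter_upwards [hX, Lp.coeFn_smul r X] with ω h1 h2
          rw [h2]
          exact mul_nonneg hr h1))
      rw [map_neg, map_smul, smul_eq_mul] at h
      linarith
    have hp : 0 < M * -g X := mul_pos hμ0 (neg_pos.2 hneg')
    have h := hb ((|K - m + g z₀| + 1) / (M * -g X)) (by positivity)
    rw [div_mul_cancel₀ _ hp.ne'] at h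
    linarith [le_abs_self (K - m + g z₀)]
  · change g _ = 1
    set s := g (Lp.const ∞ P 1)
    -- Constants of either sign are allowed, so a linear function of `c` bounded above must have
    -- slope zero.
    have hb : ∀ c : ℝ, c * (M * (s - 1)) ≤ K - m + g z₀ := fun c => by
      have h := hconst (Lp.const ∞ P c)
      have h1 : ∫ a, ρ a (Lp.const ∞ P c) ∂μ = K + M * c := by
        have h2 : ∀ a, ρ a (Lp.const ∞ P c) = ρ a 0 + c := fun a => by
          rw [← (hρ a).cash_additive, zero_add]
        simp_rw [h2]
        rw [integral_add (hci 0) (integrable_const c), integral_const, smul_eq_mul]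
      have h3 : g (Lp.const ∞ P c) = c * s := by
        have h4 : Lp.const ∞ P c = c • Lp.const ∞ P (1 : ℝ) := by
          have := (Lp.constₗ ∞ P ℝ (E := ℝ)).map_smul c 1
          simpa only [Lp.constₗ_apply, smul_eq_mul, mul_one] using this
        rw [h4, map_smul, smul_eq_mul]
      rw [h1, h3] at h
      linarith
    by_contra hs
    have hne : M * (s - 1) ≠ 0 := mul_ne_zero hμ0.ne' (sub_ne_zero.2 hs)
    have h := hb ((|K - m + g z₀| + 1) / (M * (s - 1)))
    rw [div_mul_cancel₀ _ hne] at h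
    linarith [le_abs_self (K - m + g z₀)]

/-- A constant shift carries an allocation for `Z₀` with finite positive part to one for `Z₁`. An
infinite negative part would then drive the value at `Z₁` to `⊥`. -/
theorem exists_mem_feasibleAllocations_integrable (hF : {s : Set Ω | MeasurableSet s}.Finite)
    (hμ0 : 0 < μ.real Set.univ) {ρ : A → Lp ℝ ∞ P → ℝ} (hρ : ∀ a, IsRiskMeasure (ρ a))
    (hρ_meas : MeasurablePreferences ρ) {Z₀ Z₁ : Lp ℝ ∞ P} (h₀ : integralInfConv μ ρ Z₀ ≠ ⊤)
    (h₁ : integralInfConv μ ρ Z₁ ≠ ⊥) :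
    ∃ X ∈ feasibleAllocations μ Z₁, Integrable (fun a => ρ a (X a)) μ := by
  have := finiteDimensional_Lp_top (P := P) hF
  have : CompleteSpace (Lp ℝ ∞ P) := FiniteDimensional.complete ℝ _
  obtain ⟨X, hX, hlt⟩ : ∃ X ∈ feasibleAllocations μ Z₀,
      extendedIntegral μ (fun a => ρ a (X a)) < ⊤ := by
    have := h₀.lt_top
    simpa only [integralInfConv, iInf_lt_iff, exists_prop] using this
  have hpos := lintegral_ofReal_lt_top_of_extendedIntegral_ne_top hlt.ne
  obtain ⟨hXm, hXi, hXZ⟩ := (mem_feasibleAllocations_iff hF).1 hX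
  set w : Lp ℝ ∞ P := (μ.real Set.univ)⁻¹ • (Z₁ - Z₀) with hw
  have hX' : (fun a => X a + w) ∈ feasibleAllocations μ Z₁ := by
    refine (mem_feasibleAllocations_iff hF).2
      ⟨hXm.add stronglyMeasurable_const, hXi.add (integrable_const w), ?_⟩
    rw [integral_add hXi (integrable_const w), integral_const, hw, smul_smul,
      mul_inv_cancel₀ hμ0.ne', one_smul, hXZ, add_sub_cancel]
  refine ⟨_, hX', integrable_of_extendedIntegral_ne_bot (hρ_meas _ hX'.1.1) ?_ fun hbot => ?_⟩
  · have hle : ∀ a, ENNReal.ofReal (ρ a (X a + w)) ≤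
        ENNReal.ofReal (ρ a (X a)) + ENNReal.ofReal ‖w‖ := fun a => by
      refine (ENNReal.ofReal_le_ofReal ?_).trans ENNReal.ofReal_add_le
      have := (abs_le.1 (abs_sub_le_of_lipschitzWith_one (hρ a).lipschitzWith (X a + w) (X a))).2
      rw [add_sub_cancel_left] at this
      linarith
    refine (lintegral_mono hle).trans_lt ?_
    rw [lintegral_add_right _ measurable_const, lintegral_const]
    exact ENNReal.add_lt_top.2 ⟨hpos, ENNReal.mul_lt_top ENNReal.ofReal_lt_top (measure_lt_top _ _)⟩
  · exact h₁ (eq_bot_iff.2 ((iInf₂_le _ hX').trans_eq hbot))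

end Main

end RiskSharing

theorem theorem4p2
    {A : Type*} [MeasurableSpace A] (μ : Measure A) [IsFiniteMeasure μ] [μ.IsComplete]
    (hμ_pos : 0 < μ Set.univ) (hμ : RiskSharing.NonAtomic μ)
    {Ω : Type*} [MeasurableSpace Ω] (P : Measure Ω) [IsProbabilityMeasure P]
    (hF : {s : Set Ω | MeasurableSet s}.Finite)
    (ρ : A → Lp ℝ ∞ P → ℝ)
    (hρ : ∀ a, RiskSharing.IsRiskMeasure (ρ a))
    (hρ_meas : RiskSharing.MeasurablePreferences ρ)
    (hρ_deg : ∀ a, RiskSharing.ConjugatelyDegenerate (ρ a)) :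
    (∀ Z : Lp ℝ ∞ P, RiskSharing.integralInfConv μ ρ Z = ⊤) ∨
      (∀ Z : Lp ℝ ∞ P, RiskSharing.integralInfConv μ ρ Z = ⊥) := by
  open RiskSharing in
  by_contra! hcon
  obtain ⟨⟨Z₀, h₀⟩, Z₁, h₁⟩ := hcon
  have := finiteDimensional_Lp_top (P := P) hF
  have hμ0 : 0 < μ.real Set.univ := ENNReal.toReal_pos hμ_pos.ne' (measure_ne_top _ _)
  have hLip : ∀ a, LipschitzWith 1 (ρ a) := fun a => (hρ a).lipschitzWith
  have hm : ∀ X : A → Lp ℝ ∞ P, StronglyMeasurable X → Measurable fun a => ρ a (X a) :=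
    fun X hX => hρ_meas X ((measurableAllocation_iff hF).2 hX)
  obtain ⟨X₁, hX₁, hX₁i⟩ :=
    exists_mem_feasibleAllocations_integrable hF hμ0 hρ hρ_meas h₀ h₁
  have hi : ∀ X : A → Lp ℝ ∞ P, StronglyMeasurable X → Integrable X μ →
      Integrable (fun a => ρ a (X a)) μ := fun X hXm hX =>
    integrable_comp_of_lipschitz hLip hm hX ((mem_feasibleAllocations_iff hF).1 hX₁).2.1 hXm hX₁i
  obtain ⟨m, -, hmlt⟩ := EReal.lt_iff_exists_real_btwn.1 (bot_lt_iff_ne_bot.2 h₁)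
  obtain ⟨g, hg⟩ := hμ.exists_affine_minorant hμ0 hLip hi (z₀ := Z₁) (m := m)
    fun X hXm hX hXZ => by
      have hle : integralInfConv μ ρ Z₁ ≤ extendedIntegral μ fun a => ρ a (X a) :=
        iInf₂_le X ((mem_feasibleAllocations_iff hF).2 ⟨hXm, hX, hXZ⟩)
      rw [extendedIntegral_eq_integral (hi X hXm hX)] at hle
      exact EReal.coe_le_coe_iff.1 (hmlt.le.trans hle)
  obtain ⟨Y, hY, hYg⟩ := exists_absContProbabilities_of_affine_minorant hF hμ0 hρ hi g hg
  -- The minorant caps the conjugate of the convolution at `g Z₁ - m`, so exceeding this constant is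
  -- absurd.
  obtain ⟨X, hXm, hX, hlt⟩ := exists_integral_sub_gt_of_unbounded hμ0 hLip hm hi g
    (fun a N => by simpa only [hYg] using (hρ_deg a).exists_lt_pairing_sub hY N) (g Z₁ - m)
  have := hg X hXm hX
  rw [map_sub] at this
  linarith
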